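/- For $a,b\ge 0$ put $g_{\mathrm{odd}}(b)=b^3\tanh b$ and $g_{\mathrm{even}}(b)=b^3\coth b$ (with $g_{\mathrm{even}}(0)=0$); both are increasing bijections of $[0,\infty)$ onto itself. Put $F_1(a,b)=(-a^2+b^2,\;a^2b^2)$. For an integer $l\ge 0$ let $$b_{\mathrm{odd}}(a)=g_{\mathrm{odd}}^{-1}(a^3\tan a)\quad\text{for } l\pi\le a<(l+\tfrac12)\pi,\qquad b_{\mathrm{even}}(a)=g_{\mathrm{even}}^{-1}(-a^3\cot a)\quad\text{for } (l+\tfrac12)\pi\le a<(l+1)\pi .$$ In the parameterization of the nonnegative spectrum of the free rod ($u^{(4)}-\tau u''=\mu u$ on $(-1,1)$, $u''=u'''-\tau u'=0$ at $\pm1$), the $l$-th odd and even branches in the upper half-plane $\{(\tau,\mu):\mu\ge0\}$ are, by definition, the curves $$(\tau,\mu_l^{\mathrm{odd}})=F_1(a,b_{\mathrm{odd}}(a)),\quad a\in[l\pi,(l+\tfrac12)\pi),\qquad (\tau,\mu_l^{\mathrm{even}})=F_1(a,b_{\mathrm{even}}(a)),\quad a\in[(l+\tfrac12)\pi,(l+1)\pi).$$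 **Proposition 3.6 (Direction of parameterization).** For every $l\ge 0$, along each of these two curves both $\tau$ and $\mu$ are strictly increasing functions of the parameter $a$. Hence the odd curve is the graph of a strictly increasing function $\tau\mapsto\mu_l^{\mathrm{odd}}(\tau)$ on $[-(l\pi)^2,\infty)$, and the even curve is the graph of a strictly increasing function $\tau\mapsto\mu_l^{\mathrm{even}}(\tau)$ on $[-((l+\tfrac12)\pi)^2,\infty)$. -/

import Mathlib

namespace FreeRod

open Set

/-- The map `(a, b) ↦ (τ, μ) = (-a² + b², a²b²)`, a bijection from the closed first quadrant onto
the closed upper half-plane of the `(τ, μ)`-plane. -/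
def F1 (p : ℝ × ℝ) : ℝ × ℝ := (-(p.1 ^ 2) + p.2 ^ 2, p.1 ^ 2 * p.2 ^ 2)

noncomputable def fOdd (a : ℝ) : ℝ := a ^ 3 * Real.tan a

noncomputable def gOdd (b : ℝ) : ℝ := b ^ 3 * Real.tanh b

noncomputable def fEven (a : ℝ) : ℝ := -(a ^ 3) * Real.cot a

/-- `b³ coth b` for `b > 0`; at `b = 0` the formula evaluates to `0`, which is the continuous
extension. -/
noncomputable def gEven (b : ℝ) : ℝ := b ^ 3 * (Real.cosh b / Real.sinh b)

/-- The parameter interval `[lπ, (l + 1/2)π)` of the `l`-th odd branch. -/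
noncomputable def oddInterval (l : ℕ) : Set ℝ :=
  Ico ((l : ℝ) * Real.pi) (((l : ℝ) + 1 / 2) * Real.pi)

/-- The parameter interval `[(l + 1/2)π, (l + 1)π)` of the `l`-th even branch. -/
noncomputable def evenInterval (l : ℕ) : Set ℝ :=
  Ico (((l : ℝ) + 1 / 2) * Real.pi) (((l : ℝ) + 1) * Real.pi)

/-- `b_odd(a)`: the inverse of `gOdd` on `[0, ∞)`, applied to `a³ tan a`. -/
noncomputable def bOdd (a : ℝ) : ℝ := Function.invFunOn gOdd (Ici 0) (fOdd a)

/-- `b_even(a)`: the inverse of `gEven` on `[0, ∞)`, applied to `-a³ cot a`. -/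
noncomputable def bEven (a : ℝ) : ℝ := Function.invFunOn gEven (Ici 0) (fEven a)

/-- The parameterization `a ↦ (τ, μ_l^odd)` of the odd branches. -/
noncomputable def oddCurve (a : ℝ) : ℝ × ℝ := F1 (a, bOdd a)

/-- The parameterization `a ↦ (τ, μ_l^even)` of the even branches. -/
noncomputable def evenCurve (a : ℝ) : ℝ × ℝ := F1 (a, bEven a)

/-- The `l`-th odd eigenvalue branch as a subset of the `(τ, μ)`-plane. -/
noncomputable def oddBranch (l : ℕ) : Set (ℝ × ℝ) := oddCurve '' oddInterval l

/-- The `l`-th even eigenvalue branch as a subset of the `(τ, μ)`-plane. -/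
noncomputable def evenBranch (l : ℕ) : Set (ℝ × ℝ) := evenCurve '' evenInterval l

/-! The functions `gOdd` and `gEven` are increasing bijections of `[0, ∞)`, so that `bOdd` and
`bEven` are given by true inverses. -/

theorem hasDerivAt_gOdd (x : ℝ) : HasDerivAt (fun b : ℝ => b ^ 3 * (Real.sinh b / Real.cosh b))
    (3 * x ^ 2 * (Real.sinh x / Real.cosh x) + x ^ 3 * (1 / Real.cosh x ^ 2)) x := by
  have hc := (Real.cosh_pos x).ne'
  have h := (hasDerivAt_pow 3 x).mul ((Real.hasDerivAt_sinh x).div (Real.hasDerivAt_cosh x) hc)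
  have e : Real.cosh x * Real.cosh x - Real.sinh x * Real.sinh x = 1 := by
    nlinarith [Real.cosh_sq x]
  rw [e] at h
  norm_num only [Nat.cast_ofNat, Nat.reduceSub] at h
  exact h

theorem gOdd_eq : gOdd = fun b : ℝ => b ^ 3 * (Real.sinh b / Real.cosh b) := by
  funext b
  simp [gOdd, Real.tanh_eq_sinh_div_cosh]

theorem gOdd_strictMonoOn : StrictMonoOn gOdd (Ici 0) := by
  rw [gOdd_eq]
  refine strictMonoOn_of_deriv_pos (convex_Ici 0)
    (fun x _ => (hasDerivAt_gOdd x).continuousAt.continuousWithinAt) ?_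
  intro x hx
  rw [interior_Ici, mem_Ioi] at hx
  rw [(hasDerivAt_gOdd x).deriv]
  have := Real.sinh_pos_iff.2 hx
  have := Real.cosh_pos x
  positivity

theorem gOdd_bijOn : BijOn gOdd (Ici 0) (Ici 0) := by
  have h0 : gOdd 0 = 0 := by simp [gOdd]
  refine ⟨fun x hx => ?_, gOdd_strictMonoOn.injOn, fun K hK => ?_⟩
  · have := gOdd_strictMonoOn.monotoneOn (mem_Ici.2 le_rfl) hx hx
    rwa [h0] at this
  · rw [mem_Ici] at hK
    have h1 : K ≤ gOdd (K + 1) := by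
      have hs : K + 1 ≤ Real.sinh (K + 1) := Real.self_le_sinh_iff.2 (by linarith)
      have hc := Real.cosh_pos (K + 1)
      have ht : 1 / 2 ≤ Real.sinh (K + 1) / Real.cosh (K + 1) := by
        rw [le_div_iff₀ hc]
        nlinarith [Real.cosh_sq (K + 1)]
      have h3 : 2 * K ≤ (K + 1) ^ 3 := by nlinarith [pow_nonneg hK 3, sq_nonneg K]
      rw [gOdd_eq]
      change K ≤ (K + 1) ^ 3 * (Real.sinh (K + 1) / Real.cosh (K + 1))
      nlinarith [pow_nonneg (by linarith : (0 : ℝ) ≤ K + 1) 3]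
    have hc : ContinuousOn gOdd (Icc 0 (K + 1)) := by
      rw [gOdd_eq]
      exact fun x _ => (hasDerivAt_gOdd x).continuousAt.continuousWithinAt
    obtain ⟨x, hx, hxK⟩ := intermediate_value_Icc (by linarith : (0 : ℝ) ≤ K + 1) hc
      ⟨by rwa [h0], h1⟩
    exact ⟨x, hx.1, hxK⟩

theorem hasDerivAt_gEven {x : ℝ} (hx : 0 < x) : HasDerivAt gEven
    (3 * x ^ 2 * (Real.cosh x / Real.sinh x) + x ^ 3 * (-1 / Real.sinh x ^ 2)) x := by
  have hs := (Real.sinh_pos_iff.2 hx).ne'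
  have h := (hasDerivAt_pow 3 x).mul ((Real.hasDerivAt_cosh x).div (Real.hasDerivAt_sinh x) hs)
  have e : Real.sinh x * Real.sinh x - Real.cosh x * Real.cosh x = -1 := by
    nlinarith [Real.cosh_sq x]
  rw [e] at h
  norm_num only [Nat.cast_ofNat, Nat.reduceSub] at h
  exact h

theorem gEven_pos {x : ℝ} (hx : 0 < x) : 0 < gEven x := by
  have := Real.sinh_pos_iff.2 hx
  have := Real.cosh_pos x
  unfold gEven
  positivity

theorem gEven_strictMonoOn : StrictMonoOn gEven (Ici 0) := by
  have h : StrictMonoOn gEven (Ioi 0) := by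
    refine strictMonoOn_of_deriv_pos (convex_Ioi 0)
      (fun x hx => (hasDerivAt_gEven hx).continuousAt.continuousWithinAt) ?_
    intro x hx
    rw [interior_Ioi, mem_Ioi] at hx
    rw [(hasDerivAt_gEven hx).deriv]
    have hs := Real.sinh_pos_iff.2 hx
    have hxs := Real.self_le_sinh_iff.2 hx.le
    have hc := Real.one_le_cosh x
    have he : 3 * x ^ 2 * (Real.cosh x / Real.sinh x) + x ^ 3 * (-1 / Real.sinh x ^ 2)
        = x ^ 2 * (3 * (Real.cosh x * Real.sinh x) - x) / Real.sinh x ^ 2 := by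
      field_simp
      ring
    rw [he]
    have : 0 < 3 * (Real.cosh x * Real.sinh x) - x := by nlinarith
    positivity
  intro x hx y hy hxy
  rcases (mem_Ici.1 hx).eq_or_lt with rfl | hx'
  · have : gEven 0 = 0 := by simp [gEven]
    rw [this]
    exact gEven_pos hxy
  · exact h hx' (hx'.trans hxy) hxy

theorem gEven_bijOn : BijOn gEven (Ici 0) (Ici 0) := by
  have h0 : gEven 0 = 0 := by simp [gEven]
  refine ⟨fun x hx => ?_, gEven_strictMonoOn.injOn, fun K hK => ?_⟩
  · have := gEven_strictMonoOn.monotoneOn (mem_Ici.2 le_rfl) hx hx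
    rwa [h0] at this
  · rcases (mem_Ici.1 hK).eq_or_lt with rfl | hK'
    · exact ⟨0, mem_Ici.2 le_rfl, h0⟩
    have hc : ContinuousOn (fun x : ℝ => x ^ 2 * Real.cosh x) (Icc 0 (K + 1)) :=
      ((continuous_id.pow 2).mul Real.continuous_cosh).continuousOn
    have h2 : K ≤ (K + 1) ^ 2 * Real.cosh (K + 1) := by
      nlinarith [Real.one_le_cosh (K + 1), sq_nonneg (K + 1), sq_nonneg K]
    obtain ⟨x, hx, hxK⟩ := intermediate_value_Icc (by linarith : (0 : ℝ) ≤ K + 1) hc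
      ⟨by simpa using hK'.le, h2⟩
    simp only at hxK
    have hx0 : 0 < x := by
      rcases hx.1.eq_or_lt with rfl | h
      · simp at hxK
        linarith
      · exact h
    have hgx : gEven x ≤ K := by
      have hs := Real.sinh_pos_iff.2 hx0
      have hxs := Real.self_le_sinh_iff.2 hx0.le
      have hcx := Real.cosh_pos x
      rw [← hxK, gEven, mul_div_assoc', div_le_iff₀ hs]
      have : 0 ≤ x ^ 2 * Real.cosh x := by positivity
      nlinarith
    have hgy : K ≤ gEven (K + 1) := by
      have hs := Real.sinh_pos_iff.2 (by linarith : (0 : ℝ) < K + 1)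
      have h1 : 1 ≤ Real.cosh (K + 1) / Real.sinh (K + 1) := by
        rw [le_div_iff₀ hs, one_mul]
        exact (Real.sinh_lt_cosh _).le
      have h3 : K ≤ (K + 1) ^ 3 := by nlinarith [pow_pos hK' 3, sq_nonneg K]
      unfold gEven
      nlinarith
    have hc' : ContinuousOn gEven (Icc x (K + 1)) := fun z hz =>
      (hasDerivAt_gEven (hx0.trans_le hz.1)).continuousAt.continuousWithinAt
    obtain ⟨z, hz, hzK⟩ := intermediate_value_Icc hx.2 hc' ⟨hgx, hgy⟩
    exact ⟨z, hx0.le.trans hz.1, hzK⟩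

end FreeRod

namespace FreeRod

open Set Filter Topology

/-! Both curves are `F1 (a, b)` with `g b = K = a³ tan (a - s)`, where `s` is the left endpoint of
the parameter interval. Since `b` increases with `a`, so does `μ = (ab)²`. For `τ = b² - a²` one
needs `b b' > a`, that is, `a g'(b) < b f'(a)` with `f a = a³ tan (a - s)`. Both `b³ tanh b` and `b³
coth b` satisfy `g' = 3g/b + b³ - g²/b³`, while `f' = 3f/a + a³ + f²/a³`, so after clearing
denominators only a polynomial inequality in `a²`, `b²`, `K` remains (`slope_polynomial_pos`). It
holds if `a ≥ 3/2`, which covers every branch except the odd one with `l = 0`; there `a ≤ b` takes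
over. The range of `τ` follows from the intermediate value theorem, because `b` is unbounded near
the right endpoint. -/

/-! ### The slope inequality. -/

/-- The inequality behind `dτ/da > 0`, in terms of `A = a²`, `B = b²` and `K = g(b) = f(a)`. -/
theorem slope_polynomial_pos {A B K : ℝ} (hA : 0 < A) (hB : 0 < B) (hK : 0 < K)
    (hg : B ^ 4 ≤ K ^ 2 * (1 + B)) (h : A ≤ B ∨ 9 / 4 ≤ A) :
    0 < 3 * K * (A * B) * (B - A) - (A * B) ^ 2 * (B - A) + K ^ 2 * (A ^ 2 + B ^ 2) := by
  have hAB : 0 < A * B := mul_pos hA hB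
  rcases le_or_gt A B with hle | hlt
  · have hD : 0 ≤ B - A := by linarith
    have hS : 0 < K ^ 2 * (A ^ 2 + B ^ 2) := by positivity
    rcases le_or_gt (A * B) (3 * K) with h3 | h3
    · have := mul_nonneg (mul_nonneg hAB.le hD) (sub_nonneg.2 h3)
      nlinarith
    -- Now only the `K²` term can beat the negative one: `9K² < B⁴ ≤ K²(1 + B)` forces `B > 8`, so
    -- `1 + B ≤ 9B/8` and `K² ≥ (8/9)B³`.
    · have hKB : 3 * K < B ^ 2 := by nlinarith
      have hB8 : 8 < B := by
        have h9 : 9 * K ^ 2 < B ^ 4 := by nlinarith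
        have : K ^ 2 * 9 < K ^ 2 * (1 + B) := by linarith
        have := lt_of_mul_lt_mul_left this (sq_nonneg K)
        linarith
      have hK2 : 8 * B ^ 3 ≤ 9 * K ^ 2 := by
        have : B * (8 * B ^ 3) ≤ B * (9 * K ^ 2) := by nlinarith [sq_nonneg K]
        exact le_of_mul_le_mul_left this hB
      have h1 : 2 * A ^ 2 * K ^ 2 ≤ K ^ 2 * (A ^ 2 + B ^ 2) := by
        have : 2 * A ^ 2 ≤ A ^ 2 + B ^ 2 := by nlinarith
        nlinarith [mul_le_mul_of_nonneg_left this (sq_nonneg K)]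
      have h2 : (A * B) ^ 2 * (B - A) ≤ A ^ 2 * B ^ 3 := by
        have : 0 ≤ (A * B) ^ 2 * A := by positivity
        nlinarith
      have h3 : A ^ 2 * (8 * B ^ 3) ≤ A ^ 2 * (9 * K ^ 2) :=
        mul_le_mul_of_nonneg_left hK2 (sq_nonneg A)
      have h4 : 0 < A ^ 2 * B ^ 3 := by positivity
      have h5 : 0 ≤ 3 * K * (A * B) * (B - A) := by positivity
      nlinarith
  · have hA' : 9 / 4 ≤ A := h.resolve_left (not_le.2 hlt)
    have hD : 0 < A - B := by linarith
    have hS : 0 < 4 * (A ^ 2 + B ^ 2) := by positivity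
    have hd : 0 < 4 * (A ^ 2 + B ^ 2) - 9 * (A - B) := by nlinarith
    -- As a quadratic in `K` the expression has negative discriminant, since `4A² ≥ 9A` for `A ≥
    -- 9/4`; multiplying by `4(A² + B²)` completes the square.
    have key : 0 < (A * B) ^ 2 * (A - B) * (4 * (A ^ 2 + B ^ 2) - 9 * (A - B)) := by positivity
    refine pos_of_mul_pos_right ?_ hS.le
    nlinarith [sq_nonneg (2 * (A ^ 2 + B ^ 2) * K - 3 * (A * B) * (A - B))]

theorem slope_lt {a b K : ℝ} (ha : 0 < a) (hb : 0 < b) (hK : 0 < K)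
    (hg : b ^ 8 ≤ K ^ 2 * (1 + b ^ 2)) (h : a ≤ b ∨ 3 / 2 ≤ a) :
    a * (3 * K / b + b ^ 3 - K ^ 2 / b ^ 3) < b * (3 * K / a + a ^ 3 + K ^ 2 / a ^ 3) := by
  have hP := slope_polynomial_pos (A := a ^ 2) (B := b ^ 2) (K := K) (by positivity)
    (by positivity) hK (by linarith [show (b ^ 2) ^ 4 = b ^ 8 by ring])
    (h.imp (fun h => by nlinarith) (fun h => by nlinarith))
  rw [← sub_pos]
  have e : b * (3 * K / a + a ^ 3 + K ^ 2 / a ^ 3) - a * (3 * K / b + b ^ 3 - K ^ 2 / b ^ 3)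
      = (3 * K * (a ^ 2 * b ^ 2) * (b ^ 2 - a ^ 2) - (a ^ 2 * b ^ 2) ^ 2 * (b ^ 2 - a ^ 2)
        + K ^ 2 * ((a ^ 2) ^ 2 + (b ^ 2) ^ 2)) / (a ^ 3 * b ^ 3) := by
    field_simp
    ring
  rw [e]
  positivity

/-! ### Properties shared by the two hyperbolic profiles. -/

/-- The common properties of `gOdd` and `gEven` which determine the shape of the branches. -/
structure BranchProfile (g : ℝ → ℝ) : Prop where
  strictMonoOn : StrictMonoOn g (Ici 0)
  bijOn : BijOn g (Ici 0) (Ici 0)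
  hasDerivAt : ∀ b, 0 < b → HasDerivAt g (3 * g b / b + b ^ 3 - g b ^ 2 / b ^ 3) b
  slope_pos : ∀ b, 0 < b → 0 < 3 * g b / b + b ^ 3 - g b ^ 2 / b ^ 3
  lower_bound : ∀ b, 0 < b → b ^ 8 ≤ g b ^ 2 * (1 + b ^ 2)

/-- After `cosh² = 1 + sinh²` this is just `b² ≤ sinh² b`; it gives the lower bound for `gOdd`. -/
theorem sq_le_sinh_sq_mul {b : ℝ} (hb : 0 < b) :
    b ^ 2 * Real.cosh b ^ 2 ≤ Real.sinh b ^ 2 * (1 + b ^ 2) := by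
  have h := Real.self_le_sinh_iff.2 hb.le
  rw [Real.cosh_sq]
  nlinarith

theorem branchProfile_gOdd : BranchProfile gOdd := by
  refine ⟨gOdd_strictMonoOn, gOdd_bijOn, fun b hb => ?_, fun b hb => ?_, fun b hb => ?_⟩
  · have hc := Real.cosh_pos b
    have h := hasDerivAt_gOdd b
    rw [← gOdd_eq] at h
    convert h using 1
    simp only [gOdd_eq]
    field_simp
    nlinarith [Real.cosh_sq b]
  · have hc := Real.cosh_pos b
    have hs := Real.sinh_pos_iff.2 hb
    have e : 3 * gOdd b / b + b ^ 3 - gOdd b ^ 2 / b ^ 3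
        = 3 * b ^ 2 * (Real.sinh b / Real.cosh b) + b ^ 3 * (1 / Real.cosh b ^ 2) := by
      simp only [gOdd_eq]
      field_simp
      nlinarith [Real.cosh_sq b]
    rw [e]
    positivity
  · have hc := Real.cosh_pos b
    simp only [gOdd_eq]
    have e : (b ^ 3 * (Real.sinh b / Real.cosh b)) ^ 2 * (1 + b ^ 2)
        = b ^ 6 * (Real.sinh b ^ 2 * (1 + b ^ 2)) / Real.cosh b ^ 2 := by
      field_simp
    rw [e, le_div_iff₀ (by positivity)]
    have := mul_le_mul_of_nonneg_left (sq_le_sinh_sq_mul hb) (by positivity : 0 ≤ b ^ 6)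
    nlinarith

theorem gEven_slope_eq {b : ℝ} (hb : 0 < b) :
    3 * gEven b / b + b ^ 3 - gEven b ^ 2 / b ^ 3
      = b ^ 2 * (3 * (Real.cosh b * Real.sinh b) - b) / Real.sinh b ^ 2 := by
  have hs := Real.sinh_pos_iff.2 hb
  unfold gEven
  field_simp
  nlinarith [Real.cosh_sq b]

theorem branchProfile_gEven : BranchProfile gEven := by
  refine ⟨gEven_strictMonoOn, gEven_bijOn, fun b hb => ?_, fun b hb => ?_, fun b hb => ?_⟩
  · have hs := Real.sinh_pos_iff.2 hb
    convert hasDerivAt_gEven hb using 1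
    rw [gEven_slope_eq hb]
    field_simp
    ring
  · have hs := Real.sinh_pos_iff.2 hb
    have hbs := Real.self_le_sinh_iff.2 hb.le
    have hc := Real.one_le_cosh b
    have : 0 < 3 * (Real.cosh b * Real.sinh b) - b := by nlinarith
    rw [gEven_slope_eq hb]
    positivity
  · have hs := Real.sinh_pos_iff.2 hb
    have h1 : 1 ≤ Real.cosh b / Real.sinh b := by
      rw [one_le_div hs]
      exact (Real.sinh_lt_cosh b).le
    have h3 : b ^ 3 ≤ gEven b := le_mul_of_one_le_right (by positivity) h1
    have h6 : (b ^ 3) ^ 2 ≤ gEven b ^ 2 := pow_le_pow_left₀ (by positivity) h3 2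
    nlinarith [mul_le_mul_of_nonneg_right h6 (sq_nonneg b), sq_nonneg (gEven b)]

/-! ### The inverse of a profile. -/

namespace BranchProfile

variable {g : ℝ → ℝ}

theorem map_zero (hg : BranchProfile g) : g 0 = 0 := by
  obtain ⟨x, hx, hx0⟩ := hg.bijOn.surjOn (mem_Ici.2 (le_refl (0 : ℝ)))
  have h1 := hg.strictMonoOn.monotoneOn (mem_Ici.2 le_rfl) hx hx
  have h2 : 0 ≤ g 0 := hg.bijOn.mapsTo (mem_Ici.2 le_rfl)
  linarith

theorem invFunOn_nonneg (hg : BranchProfile g) {y : ℝ} (hy : 0 ≤ y) :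
    0 ≤ Function.invFunOn g (Ici 0) y :=
  Function.invFunOn_mem (hg.bijOn.surjOn hy)

theorem apply_invFunOn (hg : BranchProfile g) {y : ℝ} (hy : 0 ≤ y) :
    g (Function.invFunOn g (Ici 0) y) = y :=
  Function.invFunOn_eq (hg.bijOn.surjOn hy)

theorem invFunOn_apply (hg : BranchProfile g) {b : ℝ} (hb : 0 ≤ b) :
    Function.invFunOn g (Ici 0) (g b) = b :=
  hg.bijOn.injOn (hg.invFunOn_nonneg (hg.bijOn.mapsTo hb)) hb
    (hg.apply_invFunOn (hg.bijOn.mapsTo hb))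

theorem invFunOn_strictMonoOn (hg : BranchProfile g) :
    StrictMonoOn (Function.invFunOn g (Ici 0)) (Ici 0) := by
  intro x hx y hy hxy
  rw [← hg.apply_invFunOn hx, ← hg.apply_invFunOn hy] at hxy
  exact (hg.strictMonoOn.lt_iff_lt (hg.invFunOn_nonneg hx) (hg.invFunOn_nonneg hy)).1 hxy

theorem invFunOn_zero (hg : BranchProfile g) : Function.invFunOn g (Ici 0) 0 = 0 := by
  have := hg.invFunOn_apply le_rfl
  rwa [hg.map_zero] at this

theorem invFunOn_pos (hg : BranchProfile g) {y : ℝ} (hy : 0 < y) :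
    0 < Function.invFunOn g (Ici 0) y := by
  have := hg.invFunOn_strictMonoOn (mem_Ici.2 le_rfl) hy.le hy
  rwa [hg.invFunOn_zero] at this

theorem image_invFunOn (hg : BranchProfile g) :
    Ici 0 ⊆ Function.invFunOn g (Ici 0) '' Ici 0 :=
  fun b hb => ⟨g b, hg.bijOn.mapsTo hb, hg.invFunOn_apply hb⟩

theorem continuousAt_invFunOn (hg : BranchProfile g) {y : ℝ} (hy : 0 < y) :
    ContinuousAt (Function.invFunOn g (Ici 0)) y :=
  hg.invFunOn_strictMonoOn.continuousAt_of_image_mem_nhds (Ici_mem_nhds hy)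
    (mem_of_superset (Ici_mem_nhds (hg.invFunOn_pos hy)) hg.image_invFunOn)

theorem continuousOn_invFunOn (hg : BranchProfile g) :
    ContinuousOn (Function.invFunOn g (Ici 0)) (Ici 0) := by
  intro y hy
  rcases (mem_Ici.1 hy).eq_or_lt with rfl | hy'
  · refine hg.invFunOn_strictMonoOn.continuousWithinAt_right_of_image_mem_nhdsWithin
      self_mem_nhdsWithin ?_
    rw [hg.invFunOn_zero]
    exact mem_of_superset self_mem_nhdsWithin hg.image_invFunOn
  · exact (hg.continuousAt_invFunOn hy').continuousWithinAt

theorem hasDerivAt_invFunOn (hg : BranchProfile g) {y : ℝ} (hy : 0 < y) :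
    HasDerivAt (Function.invFunOn g (Ici 0))
      (3 * y / Function.invFunOn g (Ici 0) y + Function.invFunOn g (Ici 0) y ^ 3
        - y ^ 2 / Function.invFunOn g (Ici 0) y ^ 3)⁻¹ y := by
  have hb := hg.invFunOn_pos hy
  have h1 := hg.hasDerivAt _ hb
  have h2 := hg.slope_pos _ hb
  rw [hg.apply_invFunOn hy.le] at h1 h2
  refine HasDerivAt.of_local_left_inverse (hg.continuousAt_invFunOn hy) h1 h2.ne' ?_
  filter_upwards [Ioi_mem_nhds hy] with z hz using hg.apply_invFunOn (le_of_lt hz)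

end BranchProfile

/-! ### The trigonometric side, with both parities as shifts of one function. -/

/-- The function `a³ tan (a - s)`, which is `fOdd` for `s = lπ` and `fEven` for
`s = (l + 1/2)π`. -/
noncomputable def shiftedTan (s a : ℝ) : ℝ := a ^ 3 * Real.tan (a - s)

theorem fOdd_eq_shiftedTan (l : ℕ) : fOdd = shiftedTan (l * Real.pi) := by
  funext a
  rw [fOdd, shiftedTan, Real.tan_sub_nat_mul_pi]

theorem fEven_eq_shiftedTan (l : ℕ) : fEven = shiftedTan (((l : ℝ) + 1 / 2) * Real.pi) := by
  funext a
  have e : a - ((l : ℝ) + 1 / 2) * Real.pi = (a - Real.pi / 2) - l * Real.pi := by ring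
  rw [fEven, shiftedTan, e, Real.tan_sub_nat_mul_pi, Real.tan_eq_sin_div_cos,
    Real.sin_sub_pi_div_two, Real.cos_sub_pi_div_two, Real.cot_eq_cos_div_sin]
  ring

section

variable {s : ℝ}

theorem cos_sub_pos {a : ℝ} (ha : a ∈ Ico s (s + Real.pi / 2)) : 0 < Real.cos (a - s) :=
  Real.cos_pos_of_mem_Ioo ⟨by linarith [ha.1, Real.pi_pos], by linarith [ha.2]⟩

theorem shiftedTan_self : shiftedTan s s = 0 := by simp [shiftedTan]

theorem shiftedTan_pos (hs : 0 ≤ s) {a : ℝ} (ha : a ∈ Ioo s (s + Real.pi / 2)) :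
    0 < shiftedTan s a := by
  have h0 : 0 < a := hs.trans_lt ha.1
  have := Real.tan_pos_of_pos_of_lt_pi_div_two (x := a - s) (by linarith [ha.1])
    (by linarith [ha.2])
  unfold shiftedTan
  positivity

theorem shiftedTan_nonneg (hs : 0 ≤ s) {a : ℝ} (ha : a ∈ Ico s (s + Real.pi / 2)) :
    0 ≤ shiftedTan s a := by
  rcases ha.1.eq_or_lt with rfl | h
  · exact shiftedTan_self.ge
  · exact (shiftedTan_pos hs ⟨h, ha.2⟩).le

theorem hasDerivAt_shiftedTan' {a : ℝ} (ha : a ∈ Ico s (s + Real.pi / 2)) :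
    HasDerivAt (shiftedTan s)
      (3 * a ^ 2 * Real.tan (a - s) + a ^ 3 * (1 / Real.cos (a - s) ^ 2)) a := by
  have h := (Real.hasDerivAt_tan (cos_sub_pos ha).ne').comp_sub_const a s
  simpa using! (hasDerivAt_pow 3 a).mul h

theorem hasDerivAt_shiftedTan (hs : 0 ≤ s) {a : ℝ} (ha : a ∈ Ioo s (s + Real.pi / 2)) :
    HasDerivAt (shiftedTan s)
      (3 * shiftedTan s a / a + a ^ 3 + shiftedTan s a ^ 2 / a ^ 3) a := by
  have h0 : 0 < a := hs.trans_lt ha.1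
  have hc := cos_sub_pos (Ioo_subset_Ico_self ha)
  convert hasDerivAt_shiftedTan' (Ioo_subset_Ico_self ha) using 1
  rw [shiftedTan, Real.tan_eq_sin_div_cos]
  field_simp
  nlinarith [Real.sin_sq_add_cos_sq (a - s)]

theorem continuousOn_shiftedTan : ContinuousOn (shiftedTan s) (Ico s (s + Real.pi / 2)) :=
  fun _ ha => (hasDerivAt_shiftedTan' ha).continuousAt.continuousWithinAt

theorem shiftedTan_strictMonoOn (hs : 0 ≤ s) :
    StrictMonoOn (shiftedTan s) (Ico s (s + Real.pi / 2)) := by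
  refine strictMonoOn_of_deriv_pos (convex_Ico _ _) continuousOn_shiftedTan fun a ha => ?_
  rw [interior_Ico] at ha
  rw [(hasDerivAt_shiftedTan hs ha).deriv]
  have h0 : 0 < a := hs.trans_lt ha.1
  have := shiftedTan_pos hs ha
  positivity

theorem exists_le_shiftedTan (hs : 0 ≤ s) (y : ℝ) :
    ∃ a ∈ Ico s (s + Real.pi / 2), y ≤ shiftedTan s a := by
  -- Nonnegativity of `tan x` together with `x > 1` ensures that the factor `(s + x)³ ≥ 1` only
  -- helps.
  have h1 : ∀ᶠ x in 𝓝[<] (Real.pi / 2), max y 0 ≤ Real.tan x :=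
    Real.tendsto_tan_pi_div_two.eventually_ge_atTop _
  have h2 : ∀ᶠ x in 𝓝[<] (Real.pi / 2), x ∈ Ioo 1 (Real.pi / 2) :=
    Ioo_mem_nhdsLT (by linarith [Real.pi_gt_three])
  obtain ⟨x, hx, hx1, hx2⟩ := (h1.and h2).exists
  refine ⟨s + x, ⟨by linarith, by linarith⟩, ?_⟩
  have h3 : (1 : ℝ) ≤ (s + x) ^ 3 := one_le_pow₀ (by linarith)
  have h4 : 0 ≤ Real.tan x := (le_max_right _ _).trans hx
  rw [shiftedTan, add_sub_cancel_left]
  exact ((le_max_left _ _).trans hx).trans (le_mul_of_one_le_left h4 h3)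

end

theorem exists_graph_of_strictMonoOn {I J : Set ℝ} {c : ℝ → ℝ × ℝ}
    (h1 : StrictMonoOn (fun a => (c a).1) I) (h2 : StrictMonoOn (fun a => (c a).2) I)
    (hJ : (fun a => (c a).1) '' I = J) :
    ∃ m : ℝ → ℝ, c '' I = (fun τ => (τ, m τ)) '' J ∧ StrictMonoOn m J := by
  have hinv : ∀ a ∈ I, Function.invFunOn (fun a => (c a).1) I (c a).1 = a := fun a ha =>
    h1.injOn.leftInvOn_invFunOn ha
  refine ⟨fun τ => (c (Function.invFunOn (fun a => (c a).1) I τ)).2, ?_, ?_⟩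
  · rw [← hJ, image_image]
    refine image_congr fun a ha => ?_
    simp only [hinv a ha]
  · rw [← hJ]
    rintro _ ⟨x, hx, rfl⟩ _ ⟨y, hy, rfl⟩ hxy
    simp only [hinv x hx, hinv y hy]
    exact h2 hx hy ((h1.lt_iff_lt hx hy).1 hxy)

/-! ### Monotonicity and range along a branch. -/

/-- The parameterization of the branch with profile `g` and parameter interval starting at `s`. -/
noncomputable def profileCurve (g : ℝ → ℝ) (s a : ℝ) : ℝ × ℝ :=
  F1 (a, Function.invFunOn g (Ici 0) (shiftedTan s a))

namespace BranchProfile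

variable {g : ℝ → ℝ} {s : ℝ}

theorem continuousOn_profileCurve_fst (hg : BranchProfile g) (hs : 0 ≤ s) :
    ContinuousOn (fun a => (profileCurve g s a).1) (Ico s (s + Real.pi / 2)) :=
  ((continuous_id.pow 2).neg.continuousOn).add
    ((hg.continuousOn_invFunOn.comp continuousOn_shiftedTan
      fun _ ha => shiftedTan_nonneg hs ha).pow 2)

theorem profileCurve_fst_strictMonoOn (hg : BranchProfile g) (hs : 0 ≤ s)
    (h : 3 / 2 ≤ s ∨ s = 0 ∧ ∀ b, 0 < b → g b ≤ b ^ 4) :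
    StrictMonoOn (fun a => (profileCurve g s a).1) (Ico s (s + Real.pi / 2)) := by
  refine strictMonoOn_of_deriv_pos (convex_Ico _ _) (hg.continuousOn_profileCurve_fst hs)
    fun a ha => ?_
  rw [interior_Ico] at ha
  have ha0 : 0 < a := hs.trans_lt ha.1
  have hK := shiftedTan_pos hs ha
  have hd := (((hasDerivAt_pow 2 a).neg).add
    (((hg.hasDerivAt_invFunOn hK).comp a (hasDerivAt_shiftedTan hs ha)).pow 2)).deriv
  have hb := hg.invFunOn_pos hK
  have hgb := hg.apply_invFunOn hK.le
  have hsl := hg.slope_pos _ hb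
  have hlow := hg.lower_bound _ hb
  change 0 < deriv (fun a => -(a ^ 2) + Function.invFunOn g (Ici 0) (shiftedTan s a) ^ 2) a
  refine lt_of_lt_of_eq ?_ hd.symm
  simp only [Function.comp_apply]
  set b := Function.invFunOn g (Ici 0) (shiftedTan s a)
  -- For `s = 0`, `g a ≤ a⁴ ≤ a³ tan a = g b` gives `a ≤ b`.
  have hab : a ≤ b ∨ 3 / 2 ≤ a := by
    rcases h with h | ⟨rfl, h⟩
    · exact Or.inr (h.trans ha.1.le)
    · refine Or.inl ((hg.strictMonoOn.le_iff_le ha0.le hb.le).1 ?_)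
      have ht : a ≤ Real.tan a := Real.le_tan ha0.le (by simpa using ha.2)
      rw [hgb, shiftedTan, sub_zero]
      calc g a ≤ a ^ 4 := h a ha0
        _ = a ^ 3 * a := by ring
        _ ≤ a ^ 3 * Real.tan a := by gcongr
  rw [hgb] at hsl hlow
  have hlt := slope_lt ha0 hb hK hlow hab
  rw [mul_comm a, ← lt_div_iff₀' hsl] at hlt
  rw [div_eq_mul_inv] at hlt
  norm_num
  linarith

theorem profileCurve_snd_strictMonoOn (hg : BranchProfile g) (hs : 0 ≤ s) :
    StrictMonoOn (fun a => (profileCurve g s a).2) (Ico s (s + Real.pi / 2)) := by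
  intro x hx y hy hxy
  have hx0 : 0 ≤ x := hs.trans hx.1
  have hKx := shiftedTan_nonneg hs hx
  have hb := hg.invFunOn_strictMonoOn hKx (shiftedTan_nonneg hs hy)
    (shiftedTan_strictMonoOn hs hx hy hxy)
  have hb0 := hg.invFunOn_nonneg hKx
  change x ^ 2 * _ ^ 2 < y ^ 2 * _ ^ 2
  rw [← mul_pow, ← mul_pow]
  have hxb := mul_lt_mul'' hxy hb hx0 hb0
  exact pow_lt_pow_left₀ hxb (mul_nonneg hx0 hb0) two_ne_zero

theorem profileCurve_fst_self (hg : BranchProfile g) : (profileCurve g s s).1 = -s ^ 2 := by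
  simp [profileCurve, F1, shiftedTan_self, hg.invFunOn_zero]

theorem image_profileCurve_fst (hg : BranchProfile g) (hs : 0 ≤ s)
    (hmono : StrictMonoOn (fun a => (profileCurve g s a).1) (Ico s (s + Real.pi / 2))) :
    (fun a => (profileCurve g s a).1) '' Ico s (s + Real.pi / 2) = Ici (-s ^ 2) := by
  have hs' : s ∈ Ico s (s + Real.pi / 2) := ⟨le_rfl, by linarith [Real.pi_pos]⟩
  refine Subset.antisymm ?_ fun τ hτ => ?_
  · rintro _ ⟨a, ha, rfl⟩
    rw [mem_Ici, ← hg.profileCurve_fst_self]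
    exact hmono.monotoneOn hs' ha ha.1
  · rw [mem_Ici] at hτ
    -- Chosen so that `b ≥ B` and `a < s + π/2` give `b² - a² ≥ τ`.
    set B := √(τ + (s + Real.pi / 2) ^ 2) with hB
    obtain ⟨c, hc, hgc⟩ := exists_le_shiftedTan hs (g B)
    have hpi := Real.pi_pos
    have hBsq : B ^ 2 = τ + (s + Real.pi / 2) ^ 2 := Real.sq_sqrt (by nlinarith)
    have hB0 : 0 ≤ B := Real.sqrt_nonneg _
    have hBc : B ≤ Function.invFunOn g (Ici 0) (shiftedTan s c) := by
      have := hg.invFunOn_strictMonoOn.monotoneOn (hg.bijOn.mapsTo hB0)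
        (shiftedTan_nonneg hs hc) hgc
      rwa [hg.invFunOn_apply hB0] at this
    have hτc : τ ≤ (profileCurve g s c).1 := by
      change τ ≤ -(c ^ 2) + _ ^ 2
      have h1 := pow_le_pow_left₀ hB0 hBc 2
      have h2 := pow_le_pow_left₀ (hs.trans hc.1) hc.2.le 2
      linarith
    have hsub : Icc s c ⊆ Ico s (s + Real.pi / 2) := fun x hx => ⟨hx.1, hx.2.trans_lt hc.2⟩
    obtain ⟨x, hx, rfl⟩ := intermediate_value_Icc hc.1
      ((hg.continuousOn_profileCurve_fst hs).mono hsub)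
      ⟨by simpa only [hg.profileCurve_fst_self] using hτ, hτc⟩
    exact ⟨x, hsub hx, rfl⟩

theorem profileCurve_monotone_graph (hg : BranchProfile g) (hs : 0 ≤ s)
    (h : 3 / 2 ≤ s ∨ s = 0 ∧ ∀ b, 0 < b → g b ≤ b ^ 4) :
    StrictMonoOn (fun a => (profileCurve g s a).1) (Ico s (s + Real.pi / 2)) ∧
      StrictMonoOn (fun a => (profileCurve g s a).2) (Ico s (s + Real.pi / 2)) ∧
      ∃ m : ℝ → ℝ, profileCurve g s '' Ico s (s + Real.pi / 2)
          = (fun τ : ℝ => (τ, m τ)) '' Ici (-s ^ 2) ∧ StrictMonoOn m (Ici (-s ^ 2)) := by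
  have h1 := hg.profileCurve_fst_strictMonoOn hs h
  have h2 := hg.profileCurve_snd_strictMonoOn hs
  exact ⟨h1, h2, exists_graph_of_strictMonoOn h1 h2 (hg.image_profileCurve_fst hs h1)⟩

end BranchProfile

/-! ### Specialization to the odd and even branches. -/

/-- Amounts to `tanh b ≤ b`, from `(x cosh x - sinh x)' = x sinh x ≥ 0`; needed only for the odd
branch with `l = 0`, where `a` starts at `0`. -/
theorem gOdd_le_pow_four {b : ℝ} (hb : 0 < b) : gOdd b ≤ b ^ 4 := by
  have hc := Real.cosh_pos b
  have h : Real.sinh b ≤ b * Real.cosh b := by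
    have hmono : MonotoneOn (fun x : ℝ => x * Real.cosh x - Real.sinh x) (Ici 0) := by
      have hd : ∀ x : ℝ, HasDerivAt (fun x : ℝ => x * Real.cosh x - Real.sinh x)
          (x * Real.sinh x) x := fun x => by
        have h := ((hasDerivAt_id x).mul (Real.hasDerivAt_cosh x)).sub (Real.hasDerivAt_sinh x)
        rw [one_mul, add_sub_cancel_left] at h
        exact h
      refine monotoneOn_of_deriv_nonneg (convex_Ici 0)
        (fun x _ => (hd x).continuousAt.continuousWithinAt)
        (fun x _ => (hd x).differentiableAt.differentiableWithinAt) fun x hx => ?_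
      rw [interior_Ici, mem_Ioi] at hx
      rw [(hd x).deriv]
      exact mul_nonneg hx.le (Real.sinh_nonneg_iff.2 hx.le)
    have := hmono (mem_Ici.2 le_rfl) hb.le hb.le
    simp only [zero_mul, Real.sinh_zero, sub_zero] at this
    linarith
  rw [gOdd, Real.tanh_eq_sinh_div_cosh]
  calc b ^ 3 * (Real.sinh b / Real.cosh b) ≤ b ^ 3 * b := by
        gcongr
        rwa [div_le_iff₀ hc]
    _ = b ^ 4 := by ring

theorem oddInterval_eq (l : ℕ) :
    oddInterval l = Ico ((l : ℝ) * Real.pi) (l * Real.pi + Real.pi / 2) := by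
  rw [oddInterval]
  congr 1
  ring

theorem evenInterval_eq (l : ℕ) : evenInterval l =
    Ico (((l : ℝ) + 1 / 2) * Real.pi) (((l : ℝ) + 1 / 2) * Real.pi + Real.pi / 2) := by
  rw [evenInterval]
  congr 1
  ring

theorem oddCurve_eq (l : ℕ) : oddCurve = profileCurve gOdd (l * Real.pi) := by
  funext a
  rw [oddCurve, bOdd, fOdd_eq_shiftedTan l, profileCurve]

theorem evenCurve_eq (l : ℕ) :
    evenCurve = profileCurve gEven (((l : ℝ) + 1 / 2) * Real.pi) := by
  funext a
  rw [evenCurve, bEven, fEven_eq_shiftedTan l, profileCurve]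

end FreeRod

theorem proposition3p6 (l : ℕ) :
    (StrictMonoOn (fun a : ℝ => (FreeRod.oddCurve a).1) (FreeRod.oddInterval l) ∧
      StrictMonoOn (fun a : ℝ => (FreeRod.oddCurve a).2) (FreeRod.oddInterval l) ∧
      ∃ m : ℝ → ℝ,
        FreeRod.oddBranch l =
          (fun τ : ℝ => (τ, m τ)) '' Set.Ici (-(((l : ℝ) * Real.pi) ^ 2)) ∧
        StrictMonoOn m (Set.Ici (-(((l : ℝ) * Real.pi) ^ 2)))) ∧
    (StrictMonoOn (fun a : ℝ => (FreeRod.evenCurve a).1) (FreeRod.evenInterval l) ∧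
      StrictMonoOn (fun a : ℝ => (FreeRod.evenCurve a).2) (FreeRod.evenInterval l) ∧
      ∃ m : ℝ → ℝ,
        FreeRod.evenBranch l =
          (fun τ : ℝ => (τ, m τ)) '' Set.Ici (-((((l : ℝ) + 1 / 2) * Real.pi) ^ 2)) ∧
        StrictMonoOn m (Set.Ici (-((((l : ℝ) + 1 / 2) * Real.pi) ^ 2)))) := by
  have hpi := Real.pi_gt_three
  have hl : (0 : ℝ) ≤ l := Nat.cast_nonneg l
  refine ⟨?_, ?_⟩
  · rw [FreeRod.oddBranch, FreeRod.oddCurve_eq l, FreeRod.oddInterval_eq]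
    refine FreeRod.branchProfile_gOdd.profileCurve_monotone_graph (by positivity) ?_
    rcases Nat.eq_zero_or_pos l with rfl | h
    · exact Or.inr ⟨by simp, fun b hb => FreeRod.gOdd_le_pow_four hb⟩
    · have : (1 : ℝ) ≤ l := by exact_mod_cast h
      exact Or.inl (by nlinarith)
  · rw [FreeRod.evenBranch, FreeRod.evenCurve_eq l, FreeRod.evenInterval_eq]
    exact FreeRod.branchProfile_gEven.profileCurve_monotone_graph (by positivity)
      (Or.inl (by nlinarith))
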